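/- Let $\mathcal E=\{e_1,\dots,e_n\}$ be the standard basis of $\mathbb Z^n$. For a lattice $\Lambda$ with $\mathbb Z^n\subseteq\Lambda\subset\mathbb R^n$ (of rank $n$), the defect $d(\mathcal E,\Lambda)$ is the smallest integer $d\ge 0$ such that some $n-d$ vectors of $\mathcal E$ together with some $d$ vectors of $\Lambda$ form a basis of $\Lambda$. The octahedron $O^n_{\mathcal E}=\{\lambda_1e_1+\dots+\lambda_ne_n : |\lambda_1|+\dots+|\lambda_n|\le 1\}$ is called admissible with respect to $\Lambda$ if $O^n_{\mathcal E}\cap\Lambda=\{0,\pm e_1,\dots,\pm e_n\}$. Let $\mathcal A^*_m$ be the set of all lattices $\Lambda=\langle\mathbb Z^n,a_1,\dots,a_m\rangle_{\mathbb Z}$ with $a_1,\dots,a_m\in\mathbb Q^n$ for which there is a square-free positive integer $q$ with $qa_1,\dots,qa_m\in\mathbb Z^n$, and let $$\mathcal D_n^m=\max\{\,d(\mathcal E,\Lambda) : \Lambda\in\mathcal A^*_m,\ O^n_{\mathcal E}\text{ is admissible with respect to }\Lambda\,\}.$$ Theorem 2. There exists an absolute constant $C>0$ such that $$\mathcal D_n^m\le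 C\,\frac{n\ln(m+1)}{\ln\frac nm}\left(\ln\ln\left(\frac nm\right)^m\right)^2$$ for all integers $m\ge 1$ and $n\ge m+2$ (equivalently, for all integers $1\le m<n$ with $(n/m)^m>e$, i.e. with $\ln\ln (n/m)^m>0$). -/

import Mathlib

open Module in
/-- The defect of the frame `e` with respect to the lattice `L`: the smallest `d` such that some
`n - d` vectors of the frame together with some `d` vectors of `L` form a basis of `L`. -/
noncomputable def defect {n : ℕ} (e : Fin n → (Fin n → ℝ)) (L : Submodule ℤ (Fin n → ℝ)) : ℕ :=
  sInf {d : ℕ | ∃ (S : Finset (Fin n)) (b : Basis (Fin n) ℤ L),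
    S.card + d = n ∧ ∀ i ∈ S, (b i : Fin n → ℝ) = e i}

/-- The octahedron corresponding to the frame `e`. -/
def octahedron {n : ℕ} (e : Fin n → (Fin n → ℝ)) : Set (Fin n → ℝ) :=
  {x | ∃ c : Fin n → ℝ, x = ∑ i, c i • e i ∧ ∑ i, |c i| ≤ 1}

/-- The octahedron of the frame `e` is admissible with respect to `L`: its only points in `L` are
the origin and the vectors `± e i`. -/
def IsAdmissible {n : ℕ} (e : Fin n → (Fin n → ℝ)) (L : Submodule ℤ (Fin n → ℝ)) : Prop :=
  octahedron e ∩ (L : Set (Fin n → ℝ)) =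
    {0} ∪ Set.range e ∪ Set.range (fun i => -e i)

/-- The standard basis of `ℤⁿ`. -/
def stdFrame (n : ℕ) : Fin n → (Fin n → ℝ) := fun i => Pi.single i 1

/-- The centering of `ℤⁿ` obtained by adding the rational vectors `a 0, …, a (m - 1)`. -/
def centering {n m : ℕ} (a : Fin m → (Fin n → ℚ)) : Submodule ℤ (Fin n → ℝ) :=
  Submodule.span ℤ
    (Set.range (stdFrame n) ∪ Set.range (fun (j : Fin m) (k : Fin n) => ((a j k : ℚ) : ℝ)))

/-- All centerings of `ℤⁿ` obtained by adding `m` rational vectors that have a common square-free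
denominator `q`. -/
def squarefreeCenterings (n m : ℕ) : Set (Submodule ℤ (Fin n → ℝ)) :=
  {L | ∃ a : Fin m → (Fin n → ℚ),
    (∃ q : ℕ, Squarefree q ∧ ∀ j k, ∃ z : ℤ, (q : ℚ) * a j k = (z : ℚ)) ∧ L = centering a}

/-- The maximal defect of the octahedron of the standard frame over those centerings (of `ℤⁿ`, by
`m` rational vectors with a common square-free denominator) for which it is admissible. -/
noncomputable def maxDefect (n m : ℕ) : ℕ :=
  sSup {d : ℕ | ∃ L ∈ squarefreeCenterings n m,
    IsAdmissible (stdFrame n) L ∧ d = defect (stdFrame n) L}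

theorem mem_span_stdFrame_iff {n : ℕ} (x : Fin n → ℝ) :
    x ∈ Submodule.span ℤ (Set.range (stdFrame n)) ↔ ∃ z : Fin n → ℤ, ∀ i, x i = z i := by
  rw [Submodule.mem_span_range_iff_exists_fun]
  constructor
  · rintro ⟨c, rfl⟩
    exact ⟨c, fun i => by simp [stdFrame, Finset.sum_apply, Pi.single_apply]⟩
  · rintro ⟨z, hz⟩
    refine ⟨z, ?_⟩
    ext i
    simp [stdFrame, Finset.sum_apply, Pi.single_apply, hz]

theorem linearIndependent_stdFrame (n : ℕ) : LinearIndependent ℤ (stdFrame n) := by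
  rw [Fintype.linearIndependent_iff]
  intro g hg i
  have := congrFun hg i
  simpa [stdFrame, Finset.sum_apply, Pi.single_apply] using this

open Module in
/-- The minimum in the definition of the defect is attained. -/
theorem defect_spec {n m : ℕ} {L : Submodule ℤ (Fin n → ℝ)} (hL : L ∈ squarefreeCenterings n m) :
    ∃ (S : Finset (Fin n)) (b : Basis (Fin n) ℤ L),
      S.card + defect (stdFrame n) L = n ∧ ∀ i ∈ S, (b i : Fin n → ℝ) = stdFrame n i := by
  refine Nat.sInf_mem (s := {d : ℕ | ∃ (S : Finset (Fin n)) (b : Basis (Fin n) ℤ L),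
    S.card + d = n ∧ ∀ i ∈ S, (b i : Fin n → ℝ) = stdFrame n i}) ?_
  obtain ⟨a, ⟨q, hq, ha⟩, rfl⟩ := hL
  have hq0 : q ≠ 0 := hq.ne_zero
  have : Module.Finite ℤ (centering a) :=
    Module.Finite.span_of_finite ℤ ((Set.finite_range _).union (Set.finite_range _))
  set Z := Submodule.span ℤ (Set.range (stdFrame n)) with hZ
  have hfZ : Module.Finite ℤ Z := Module.Finite.span_of_finite ℤ (Set.finite_range _)
  have hrZ : finrank ℤ Z = n := by
    rw [hZ, finrank_span_eq_card (linearIndependent_stdFrame n), Fintype.card_fin]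
  have hle : Z ≤ centering a := Submodule.span_mono Set.subset_union_left
  have hmul : ∀ x ∈ centering a, (q : ℤ) • x ∈ Z := by
    intro x hx
    have : centering a ≤ Z.comap ((q : ℤ) • LinearMap.id) := by
      refine Submodule.span_le.2 ?_
      rintro y (hy | ⟨j, rfl⟩)
      · exact Z.smul_mem _ (Submodule.subset_span hy)
      · refine (mem_span_stdFrame_iff _).2 ?_
        choose z hz using ha j
        refine ⟨z, fun i => ?_⟩
        have := congrArg (fun t : ℚ => (t : ℝ)) (hz i)
        simpa using this
    exact this hx
  have h1 : n ≤ finrank ℤ (centering a) := by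
    have := LinearMap.finrank_le_finrank_of_injective (Submodule.inclusion_injective hle)
    omega
  have h2 : finrank ℤ (centering a) ≤ n := by
    let f : centering a →ₗ[ℤ] Z :=
      (((q : ℤ) • (LinearMap.id : (Fin n → ℝ) →ₗ[ℤ] _)).domRestrict (centering a)).codRestrict Z
        (fun x => hmul x x.2)
    have hf : Function.Injective f := by
      intro x y hxy
      have h := congrArg (fun t : Z => (t : Fin n → ℝ)) hxy
      have h' : (q : ℤ) • (x : Fin n → ℝ) = (q : ℤ) • (y : Fin n → ℝ) := h
      exact Subtype.ext (smul_right_injective _ (by exact_mod_cast hq0) h')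
    have := LinearMap.finrank_le_finrank_of_injective hf
    omega
  exact ⟨n, ∅, finBasisOfFinrankEq ℤ _ (le_antisymm h2 h1), by simp, by simp⟩

theorem centering_zero (n m : ℕ) :
    centering (0 : Fin m → (Fin n → ℚ)) = Submodule.span ℤ (Set.range (stdFrame n)) := by
  refine le_antisymm (Submodule.span_le.2 ?_) (Submodule.span_mono Set.subset_union_left)
  rintro y (hy | ⟨j, rfl⟩)
  · exact Submodule.subset_span hy
  · exact (mem_span_stdFrame_iff _).2 ⟨0, fun i => by simp⟩

theorem isAdmissible_int (n : ℕ) :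
    IsAdmissible (stdFrame n) (Submodule.span ℤ (Set.range (stdFrame n))) := by
  have key : ∀ (i : Fin n) (s : ℝ), |s| ≤ 1 → s • stdFrame n i ∈ octahedron (stdFrame n) := by
    intro i s hs
    refine ⟨Pi.single i s, ?_, ?_⟩
    · simp [Pi.single_apply, ite_smul]
    · simpa [Pi.single_apply, apply_ite abs] using hs
  ext x
  constructor
  · rintro ⟨⟨c, hx, hc⟩, hxZ⟩
    obtain ⟨z, hz⟩ := (mem_span_stdFrame_iff x).1 hxZ
    have hcz : ∀ i, c i = z i := fun i => by
      rw [← hz i, hx]; simp [stdFrame, Finset.sum_apply, Pi.single_apply]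
    have hsum : ∑ i, |z i| ≤ 1 := by
      have : ∑ i, |(z i : ℝ)| ≤ 1 := by simpa [hcz] using hc
      exact_mod_cast this
    by_cases h0 : ∀ i, z i = 0
    · refine Or.inl (Or.inl ?_)
      ext i
      simp [hz, h0]
    · push Not at h0
      obtain ⟨i, hi⟩ := h0
      have hi1 : 1 ≤ |z i| := Int.one_le_abs hi
      have hsplit := Finset.add_sum_erase Finset.univ (fun k => |z k|) (Finset.mem_univ i)
      have hnn : 0 ≤ ∑ k ∈ Finset.univ.erase i, |z k| :=
        Finset.sum_nonneg fun k _ => abs_nonneg _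
      have hz0 : ∀ k, k ≠ i → z k = 0 := by
        intro k hk
        have h := Finset.single_le_sum (f := fun k => |z k|) (fun k _ => abs_nonneg _)
          (Finset.mem_erase.2 ⟨hk, Finset.mem_univ k⟩)
        have : |z k| ≤ 0 := by linarith
        exact abs_nonpos_iff.1 this
      have habs : |z i| = 1 := by linarith
      rcases (abs_eq (by norm_num : (0 : ℤ) ≤ 1)).1 habs with h | h
      · refine Or.inl (Or.inr ⟨i, ?_⟩)
        ext k
        rcases eq_or_ne k i with rfl | hk
        · simp [stdFrame, hz, h]
        · simp [stdFrame, hz, hz0 k hk, hk]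
      · refine Or.inr ⟨i, ?_⟩
        ext k
        rcases eq_or_ne k i with rfl | hk
        · simp [stdFrame, hz, h]
        · simp [stdFrame, hz, hz0 k hk, hk]
  · rintro ((rfl | ⟨i, rfl⟩) | ⟨i, rfl⟩)
    · exact ⟨⟨0, by simp, by simp⟩, Submodule.zero_mem _⟩
    · exact ⟨by simpa using key i 1 (by simp), Submodule.subset_span ⟨i, rfl⟩⟩
    · exact ⟨by simpa using key i (-1) (by simp),
        Submodule.neg_mem _ (Submodule.subset_span ⟨i, rfl⟩)⟩

/-- The maximum in the definition of `maxDefect` is attained. -/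
theorem maxDefect_isGreatest (n m : ℕ) :
    IsGreatest {d : ℕ | ∃ L ∈ squarefreeCenterings n m,
      IsAdmissible (stdFrame n) L ∧ d = defect (stdFrame n) L} (maxDefect n m) := by
  have hne : {d : ℕ | ∃ L ∈ squarefreeCenterings n m,
      IsAdmissible (stdFrame n) L ∧ d = defect (stdFrame n) L}.Nonempty :=
    ⟨_, centering (0 : Fin m → (Fin n → ℚ)),
      ⟨0, ⟨1, squarefree_one, fun _ _ => ⟨0, by simp⟩⟩, rfl⟩,
      by rw [centering_zero]; exact isAdmissible_int n, rfl⟩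
  have hbd : BddAbove {d : ℕ | ∃ L ∈ squarefreeCenterings n m,
      IsAdmissible (stdFrame n) L ∧ d = defect (stdFrame n) L} := by
    refine ⟨n, ?_⟩
    rintro d ⟨L, hL, -, rfl⟩
    obtain ⟨S, b, h, -⟩ := defect_spec hL
    omega
  exact ⟨Nat.sSup_mem hne hbd, fun d hd => le_csSup hbd hd⟩

/-! For each prime `p ∣ q` the `p`-torsion of `L / ℤⁿ` is a linear code over `ℤ/p`, of dimension at
most `m` because `q` is square-free. If a coordinate set `T` is such that no nonzero word of any of
these codes vanishes on `T`, the unit vectors outside `T` extend to a basis of `L`, so the defect is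
at most `|T|`. The task is to find a small `T`.

Admissibility enters only through pigeonhole: a code of dimension `j` with support of size `k`
satisfies `p ^ j ≤ k ^ k` (`pow_codeDim_le`), and all codes together satisfy `∏ p ^ dim ≤ n ^ n`
(`prod_pow_codeDim_le`). Put `y = n/m`, `l = log y`, `X = m l`. For `p > √y` the first bound makes
the support at least of order `l j / log X`, so a random coordinate lowers the dimension by a factor
of about `1 - l / (2 n log X)` on average. The second bounds the initial total by `4n`. Hence about
`2 n (log X)² / l` greedy coordinates leave total dimension `O(n / l)`. Primes up to `√y` contribute
at most `m √y = O(n / l)`, and each remaining dimension costs one further coordinate. -/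

/-! ### Pigeonhole in an admissible lattice -/

theorem eq_zero_of_isAdmissible {n : ℕ} {L : Submodule ℤ (Fin n → ℝ)}
    (h : IsAdmissible (stdFrame n) L) {x : Fin n → ℝ} (hx : x ∈ L) (hlt : ∑ i, |x i| < 1) :
    x = 0 := by
  have hmem : x ∈ octahedron (stdFrame n) ∩ (L : Set (Fin n → ℝ)) := by
    refine ⟨⟨x, ?_, hlt.le⟩, hx⟩
    ext i
    simp [stdFrame, Finset.sum_apply, Pi.single_apply]
  have hsmall : ∀ i, |x i| < 1 := fun i =>
    (Finset.single_le_sum (f := fun k => |x k|) (fun k _ => abs_nonneg _)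
      (Finset.mem_univ i)).trans_lt hlt
  rw [IsAdmissible] at h
  rw [h] at hmem
  rcases hmem with (h0 | ⟨i, rfl⟩) | ⟨i, rfl⟩
  · exact h0
  · have := hsmall i
    simp [stdFrame] at this
  · have := hsmall i
    simp [stdFrame] at this

/-- Pigeonhole bound: a finite family of pairwise incongruent points of an admissible lattice whose
coordinates outside `K` are integers has at most `|K| ^ |K|` members. -/
theorem card_le_pow_of_isAdmissible {n : ℕ} {L : Submodule ℤ (Fin n → ℝ)}
    (h : IsAdmissible (stdFrame n) L) (hZ : ∀ z : Fin n → ℤ, (fun i => (z i : ℝ)) ∈ L)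
    (K : Finset (Fin n)) {A : Type*} [Fintype A] (f : A → Fin n → ℝ) (hf : ∀ a, f a ∈ L)
    (hK : ∀ a, ∀ i ∉ K, ∃ z : ℤ, f a i = z)
    (hinj : ∀ a b, (∀ i, ∃ z : ℤ, f a i - f b i = z) → a = b) :
    Fintype.card A ≤ K.card ^ K.card := by
  classical
  have hbox : ∀ (a : A) (i : K), ⌊Int.fract (f a i) * (K.card : ℝ)⌋₊ < K.card := by
    intro a i
    have hk : 0 < (K.card : ℝ) := by exact_mod_cast Finset.card_pos.2 ⟨(i : Fin n), i.2⟩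
    rw [Nat.floor_lt (by positivity)]
    nlinarith [Int.fract_lt_one (f a i)]
  let g : A → (K → Fin K.card) := fun a i => ⟨_, hbox a i⟩
  have hg : Function.Injective g := by
    intro a b hab
    apply hinj
    -- Two points in the same box of side `1/|K|` differ modulo `ℤⁿ` by a lattice vector of
    -- `ℓ¹`-norm below 1, which admissibility forces to vanish.
    set y : Fin n → ℝ := fun i => Int.fract (f a i) - Int.fract (f b i) with hy
    have hyz : ∀ i, f a i - f b i = y i + ((⌊f a i⌋ - ⌊f b i⌋ : ℤ) : ℝ) := by
      intro i
      simp only [hy, Int.fract]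
      push_cast
      ring
    have hyL : y ∈ L := by
      have : y = f a - f b - fun i => ((⌊f a i⌋ - ⌊f b i⌋ : ℤ) : ℝ) := by
        ext i
        simp only [Pi.sub_apply, hyz]
        ring
      rw [this]
      exact L.sub_mem (L.sub_mem (hf a) (hf b)) (hZ _)
    have hoff : ∀ i ∉ K, |y i| = 0 := by
      intro i hi
      obtain ⟨z, hz⟩ := hK a i hi
      obtain ⟨w, hw⟩ := hK b i hi
      simp [hy, hz, hw]
    have hon : ∀ i ∈ K, |y i| < 1 / K.card := by
      intro i hi
      have hk : 0 < (K.card : ℝ) := by exact_mod_cast Finset.card_pos.2 ⟨i, hi⟩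
      have heq : ⌊Int.fract (f a i) * (K.card : ℝ)⌋₊ = ⌊Int.fract (f b i) * (K.card : ℝ)⌋₊ :=
        congrArg Fin.val (congrFun hab ⟨i, hi⟩)
      have h1 := Nat.floor_le (mul_nonneg (Int.fract_nonneg (f a i)) hk.le)
      have h2 := Nat.lt_floor_add_one (Int.fract (f a i) * (K.card : ℝ))
      have h3 := Nat.floor_le (mul_nonneg (Int.fract_nonneg (f b i)) hk.le)
      have h4 := Nat.lt_floor_add_one (Int.fract (f b i) * (K.card : ℝ))
      rw [heq] at h1 h2
      rw [lt_div_iff₀ hk, ← abs_of_pos hk, ← abs_mul, abs_lt]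
      constructor <;> simp only [hy, sub_mul] <;> linarith
    have hsum : ∑ i, |y i| < 1 := by
      rw [← Finset.sum_subset (Finset.subset_univ K) fun i _ hi => hoff i hi]
      rcases K.eq_empty_or_nonempty with rfl | hne
      · simp
      · refine (Finset.sum_lt_sum_of_nonempty hne hon).trans_le ?_
        have : (K.card : ℝ) ≠ 0 := by exact_mod_cast hne.card_pos.ne'
        simp [this]
    have hy0 := eq_zero_of_isAdmissible h hyL hsum
    intro i
    exact ⟨⌊f a i⌋ - ⌊f b i⌋, by rw [hyz, hy0]; simp⟩
  simpa using Fintype.card_le_of_injective g hg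

/-! ### Choosing coordinates -/

/-- Greedy choice: if a random element decreases every `j p` by a factor `1 - κ / n` on average,
then `N` elements can be chosen that decrease the sum by a factor `exp (-κ N / n)`. -/
theorem exists_greedy {n : ℕ} {ι : Type*} (P : Finset ι) (j : ι → Finset (Fin n) → ℕ) {κ : ℝ}
    (hn : 0 < n)
    (hj : ∀ p ∈ P, ∀ T, κ * j p T ≤ ∑ i, ((j p T : ℝ) - j p (insert i T))) (N : ℕ) :
    ∃ T : Finset (Fin n), T.card ≤ N ∧
      ∑ p ∈ P, (j p T : ℝ) ≤ (∑ p ∈ P, (j p ∅ : ℝ)) * Real.exp (-(κ * N / n)) := by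
  induction N with
  | zero => exact ⟨∅, by simp⟩
  | succ N ih =>
    obtain ⟨T, hT, hle⟩ := ih
    have hn' : (0 : ℝ) < n := by exact_mod_cast hn
    have hne : (Finset.univ : Finset (Fin n)).Nonempty := ⟨⟨0, hn⟩, Finset.mem_univ _⟩
    have havg : ∃ i : Fin n, ∑ p ∈ P, (j p (insert i T) : ℝ) ≤
        (1 - κ / n) * ∑ p ∈ P, (j p T : ℝ) := by
      have hs : ∑ i : Fin n, ∑ p ∈ P, (j p (insert i T) : ℝ) ≤
          ∑ _i : Fin n, (1 - κ / n) * ∑ p ∈ P, (j p T : ℝ) := by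
        have h1 := Finset.sum_le_sum fun p hp => hj p hp T
        rw [Finset.sum_comm, ← Finset.mul_sum] at h1
        simp only [Finset.sum_sub_distrib, Finset.sum_const, Finset.card_univ, Fintype.card_fin,
          nsmul_eq_mul] at h1 ⊢
        have : (n : ℝ) * ((1 - κ / n) * ∑ p ∈ P, (j p T : ℝ)) =
            n * ∑ p ∈ P, (j p T : ℝ) - κ * ∑ p ∈ P, (j p T : ℝ) := by
          field_simp
        rw [this]
        linarith
      obtain ⟨i, -, hi⟩ := Finset.exists_le_of_sum_le hne hs
      exact ⟨i, hi⟩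
    obtain ⟨i, hi⟩ := havg
    refine ⟨insert i T, (Finset.card_insert_le _ _).trans (by omega), hi.trans ?_⟩
    calc (1 - κ / n) * ∑ p ∈ P, (j p T : ℝ)
        ≤ Real.exp (-(κ / n)) * ∑ p ∈ P, (j p T : ℝ) := by
          gcongr
          exact Real.one_sub_le_exp_neg _
      _ ≤ Real.exp (-(κ / n)) * ((∑ p ∈ P, (j p ∅ : ℝ)) * Real.exp (-(κ * N / n))) := by gcongr
      _ = _ := by
          rw [mul_left_comm, ← Real.exp_add]
          congr 2
          push_cast
          ring

/-- While some `j p` is nonzero, one more element lowers the total by at least one, so the total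
bounds the number of additions. -/
theorem exists_completion {n : ℕ} {ι : Type*} (P : Finset ι) (j : ι → Finset (Fin n) → ℕ)
    (hanti : ∀ p ∈ P, ∀ i T, j p (insert i T) ≤ j p T)
    (hdec : ∀ p ∈ P, ∀ T, j p T ≠ 0 → ∃ i, j p (insert i T) < j p T) (T : Finset (Fin n)) :
    ∃ T' : Finset (Fin n), T'.card ≤ T.card + ∑ p ∈ P, j p T ∧ ∀ p ∈ P, j p T' = 0 := by
  induction hs : ∑ p ∈ P, j p T using Nat.strong_induction_on generalizing T with
  | _ s ih =>
    by_cases h0 : ∀ p ∈ P, j p T = 0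
    · exact ⟨T, by omega, h0⟩
    · push Not at h0
      obtain ⟨p, hp, hne⟩ := h0
      obtain ⟨i, hi⟩ := hdec p hp T hne
      have hlt : ∑ p ∈ P, j p (insert i T) < s :=
        hs ▸ Finset.sum_lt_sum (fun p hp => hanti p hp i T) ⟨p, hp, hi⟩
      obtain ⟨T', hT', h'⟩ := ih _ hlt _ rfl
      have := Finset.card_insert_le i T
      exact ⟨T', by omega, h'⟩

/-! ### Codes from the prime torsion -/

/-- The words of length `n` over `ℤ/p` that come from the `p`-torsion of `L / ℤⁿ` and vanish
on `T`. -/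
def shortenedCode {n : ℕ} (L : Submodule ℤ (Fin n → ℝ)) (p : ℕ) (T : Finset (Fin n)) :
    Submodule (ZMod p) (Fin n → ZMod p) :=
  AddSubgroup.toZModSubmodule p
    { carrier := {c | (∃ z : Fin n → ℤ, (∀ i, (z i : ZMod p) = c i) ∧
        (fun i => (z i : ℝ) / p) ∈ L) ∧ ∀ i ∈ T, c i = 0}
      zero_mem' := ⟨⟨0, by simp, by
        simp only [Pi.zero_apply, Int.cast_zero, zero_div]
        exact L.zero_mem⟩, by simp⟩
      add_mem' := by
        rintro c d ⟨⟨z, hz, hzL⟩, hc⟩ ⟨⟨w, hw, hwL⟩, hd⟩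
        refine ⟨⟨z + w, fun i => by simp [hz, hw], ?_⟩, fun i hi => by simp [hc i hi, hd i hi]⟩
        convert L.add_mem hzL hwL using 1
        ext i
        simp [add_div]
      neg_mem' := by
        rintro c ⟨⟨z, hz, hzL⟩, hc⟩
        refine ⟨⟨-z, fun i => by simp [hz], ?_⟩, fun i hi => by simp [hc i hi]⟩
        convert L.neg_mem hzL using 1
        ext i
        simp [neg_div] }

theorem mem_shortenedCode {n : ℕ} {L : Submodule ℤ (Fin n → ℝ)} {p : ℕ} {T : Finset (Fin n)}
    {c : Fin n → ZMod p} :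
    c ∈ shortenedCode L p T ↔ (∃ z : Fin n → ℤ, (∀ i, (z i : ZMod p) = c i) ∧
        (fun i => (z i : ℝ) / p) ∈ L) ∧ ∀ i ∈ T, c i = 0 :=
  Iff.rfl

/-- Two integer lifts of a word differ by a multiple of `p`, which becomes an element of `ℤⁿ ⊆ L`
after division by `p`; so the choice of lift is immaterial. -/
theorem intCast_mem_shortenedCode {n : ℕ} {L : Submodule ℤ (Fin n → ℝ)}
    (hZ : ∀ z : Fin n → ℤ, (fun i => (z i : ℝ)) ∈ L) {p : ℕ} (hp : p ≠ 0) {T : Finset (Fin n)}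
    (z : Fin n → ℤ) :
    (fun i => (z i : ZMod p)) ∈ shortenedCode L p T ↔
      (fun i => (z i : ℝ) / p) ∈ L ∧ ∀ i ∈ T, (p : ℤ) ∣ z i := by
  have hp' : (p : ℝ) ≠ 0 := by exact_mod_cast hp
  simp only [mem_shortenedCode, ZMod.intCast_zmod_eq_zero_iff_dvd,
    ZMod.intCast_eq_intCast_iff_dvd_sub]
  refine and_congr_left fun _ => ⟨?_, fun h => ⟨z, by simp, h⟩⟩
  rintro ⟨w, hw, hwL⟩
  choose u hu using hw
  convert L.add_mem hwL (hZ u) using 1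
  ext i
  have : (z i : ℝ) = w i + p * u i := by
    have := hu i
    have h' : z i = w i + p * u i := by linarith
    exact_mod_cast h'
  simp only [this, Pi.add_apply]
  field_simp

theorem val_div_mem_of_mem_shortenedCode {n : ℕ} {L : Submodule ℤ (Fin n → ℝ)}
    (hZ : ∀ z : Fin n → ℤ, (fun i => (z i : ℝ)) ∈ L) {p : ℕ} (hp : p ≠ 0) {T : Finset (Fin n)}
    {c : Fin n → ZMod p} (hc : c ∈ shortenedCode L p T) :
    (fun i => ((c i).val : ℝ) / p) ∈ L := by
  have : NeZero p := ⟨hp⟩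
  have := (intCast_mem_shortenedCode hZ hp (T := T) fun i => ((c i).val : ℤ)).1
    (by simpa using hc)
  simpa using this.1

theorem shortenedCode_anti {n : ℕ} (L : Submodule ℤ (Fin n → ℝ)) (p : ℕ) {T U : Finset (Fin n)}
    (h : T ⊆ U) : shortenedCode L p U ≤ shortenedCode L p T :=
  fun _ hc => ⟨hc.1, fun i hi => hc.2 i (h hi)⟩

/-- The dimension of the shortened code. -/
noncomputable def codeDim {n : ℕ} (L : Submodule ℤ (Fin n → ℝ)) (p : ℕ) (T : Finset (Fin n)) : ℕ :=
  Module.finrank (ZMod p) (shortenedCode L p T)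

open Classical in
/-- The support of the shortened code. -/
noncomputable def codeSupport {n : ℕ} (L : Submodule ℤ (Fin n → ℝ)) (p : ℕ)
    (T : Finset (Fin n)) : Finset (Fin n) :=
  {i | ∃ c ∈ shortenedCode L p T, c i ≠ 0}

theorem mem_codeSupport {n : ℕ} {L : Submodule ℤ (Fin n → ℝ)} {p : ℕ} {T : Finset (Fin n)}
    {i : Fin n} : i ∈ codeSupport L p T ↔ ∃ c ∈ shortenedCode L p T, c i ≠ 0 := by
  simp [codeSupport]

theorem codeDim_insert_le {n : ℕ} (L : Submodule ℤ (Fin n → ℝ)) {p : ℕ} (hp : p.Prime) (i : Fin n)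
    (T : Finset (Fin n)) : codeDim L p (insert i T) ≤ codeDim L p T := by
  have : Fact p.Prime := ⟨hp⟩
  exact Submodule.finrank_mono (shortenedCode_anti L p (Finset.subset_insert i T))

theorem codeDim_insert_lt {n : ℕ} {L : Submodule ℤ (Fin n → ℝ)} {p : ℕ} (hp : p.Prime) {i : Fin n}
    {T : Finset (Fin n)} (hi : i ∈ codeSupport L p T) :
    codeDim L p (insert i T) < codeDim L p T := by
  have : Fact p.Prime := ⟨hp⟩
  refine Submodule.finrank_lt_finrank_of_lt
    (lt_of_le_of_ne (shortenedCode_anti L p (Finset.subset_insert i T)) fun heq => ?_)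
  obtain ⟨c, hc, hne⟩ := mem_codeSupport.1 hi
  rw [← heq] at hc
  exact hne (hc.2 i (Finset.mem_insert_self i T))

/-- Each coordinate of the support lowers the dimension by at least one, and no coordinate raises
it. This turns a lower bound on the support into the hypothesis of `exists_greedy`. -/
theorem codeSupport_card_le {n : ℕ} (L : Submodule ℤ (Fin n → ℝ)) {p : ℕ} (hp : p.Prime)
    (T : Finset (Fin n)) :
    ((codeSupport L p T).card : ℝ) ≤ ∑ i, ((codeDim L p T : ℝ) - codeDim L p (insert i T)) := by
  rw [Finset.card_eq_sum_ones, Nat.cast_sum]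
  refine (Finset.sum_le_sum fun i hi => ?_).trans (Finset.sum_le_sum_of_subset_of_nonneg
    (Finset.subset_univ (codeSupport L p T)) fun i _ _ => ?_)
  · have : (codeDim L p (insert i T) : ℝ) + 1 ≤ codeDim L p T := by
      exact_mod_cast codeDim_insert_lt hp hi
    push_cast
    linarith
  · have : (codeDim L p (insert i T) : ℝ) ≤ codeDim L p T := by
      exact_mod_cast codeDim_insert_le L hp i T
    linarith

theorem shortenedCode_eq_bot {n : ℕ} {L : Submodule ℤ (Fin n → ℝ)} {p : ℕ} (hp : p.Prime)
    {T : Finset (Fin n)} (h : codeDim L p T = 0) : shortenedCode L p T = ⊥ := by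
  have : Fact p.Prime := ⟨hp⟩
  exact Submodule.finrank_eq_zero.1 h

theorem exists_codeDim_insert_lt {n : ℕ} {L : Submodule ℤ (Fin n → ℝ)} {p : ℕ} (hp : p.Prime)
    {T : Finset (Fin n)} (h : codeDim L p T ≠ 0) : ∃ i, codeDim L p (insert i T) < codeDim L p T := by
  have : Fact p.Prime := ⟨hp⟩
  by_contra! hle
  refine h (Submodule.finrank_eq_zero.2 ((Submodule.eq_bot_iff _).2 fun c hc => ?_))
  ext i
  by_contra hne
  exact (codeDim_insert_lt hp (mem_codeSupport.2 ⟨c, hc, hne⟩)).not_ge (hle i)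

theorem card_shortenedCode {n : ℕ} (L : Submodule ℤ (Fin n → ℝ)) {p : ℕ} (hp : p.Prime)
    (T : Finset (Fin n)) [Fintype (shortenedCode L p T)] :
    Fintype.card (shortenedCode L p T) = p ^ codeDim L p T := by
  have : Fact p.Prime := ⟨hp⟩
  rw [Module.card_eq_pow_finrank (K := ZMod p), ZMod.card, codeDim]

theorem finite_shortenedCode {n : ℕ} (L : Submodule ℤ (Fin n → ℝ)) {p : ℕ} (hp : p ≠ 0)
    (T : Finset (Fin n)) : Finite (shortenedCode L p T) := by
  have : NeZero p := ⟨hp⟩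
  infer_instance

/-- Distinct words, lifted and divided by `p`, are incongruent lattice points whose coordinates off
the support are 0, so pigeonhole applies on the support. -/
theorem pow_codeDim_le {n : ℕ} {L : Submodule ℤ (Fin n → ℝ)} (h : IsAdmissible (stdFrame n) L)
    (hZ : ∀ z : Fin n → ℤ, (fun i => (z i : ℝ)) ∈ L) {p : ℕ} (hp : p.Prime)
    (T : Finset (Fin n)) :
    p ^ codeDim L p T ≤ (codeSupport L p T).card ^ (codeSupport L p T).card := by
  have : Fact p.Prime := ⟨hp⟩
  have := finite_shortenedCode L hp.ne_zero T
  have := Fintype.ofFinite (shortenedCode L p T)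
  rw [← card_shortenedCode L hp T]
  have hp' : (p : ℝ) ≠ 0 := by exact_mod_cast hp.ne_zero
  refine card_le_pow_of_isAdmissible h hZ _ (fun c i => ((c.1 i).val : ℝ) / p)
    (fun c => val_div_mem_of_mem_shortenedCode hZ hp.ne_zero c.2) ?_ ?_
  · intro c i hi
    refine ⟨0, ?_⟩
    have : c.1 i = 0 := by
      by_contra hne
      exact hi (mem_codeSupport.2 ⟨c.1, c.2, hne⟩)
    simp [this]
  · intro c d hcd
    ext i
    obtain ⟨z, hz⟩ := hcd i
    have : ((c.1 i).val : ℤ) = (d.1 i).val + z * p := by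
      field_simp at hz
      have h' : ((c.1 i).val : ℝ) = (d.1 i).val + z * p := by linarith
      exact_mod_cast h'
    simpa using congrArg (fun t : ℤ => (t : ZMod p)) this

/-- Torsion at different primes is independent: by the Chinese remainder theorem, sums of one point
per prime stay incongruent modulo `ℤⁿ`. Pigeonhole is then applied on all coordinates. -/
theorem prod_pow_codeDim_le {n : ℕ} {L : Submodule ℤ (Fin n → ℝ)}
    (h : IsAdmissible (stdFrame n) L) (hZ : ∀ z : Fin n → ℤ, (fun i => (z i : ℝ)) ∈ L)
    (s : Finset ℕ) (hs : ∀ p ∈ s, p.Prime) : ∏ p ∈ s, p ^ codeDim L p ∅ ≤ n ^ n := by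
  classical
  have : ∀ p : s, Finite (shortenedCode L (p : ℕ) ∅) := fun p =>
    finite_shortenedCode L (hs p p.2).ne_zero ∅
  have : ∀ p : s, Fintype (shortenedCode L (p : ℕ) ∅) := fun p => Fintype.ofFinite _
  have hcard : Fintype.card (∀ p : s, shortenedCode L (p : ℕ) ∅) =
      ∏ p ∈ s, p ^ codeDim L p ∅ := by
    rw [Fintype.card_pi]
    exact (Finset.prod_congr rfl fun (p : s) _ => card_shortenedCode L (hs p p.2) ∅).trans
      (Finset.prod_coe_sort s fun p => p ^ codeDim L p ∅)
  rw [← hcard]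
  have hbound := card_le_pow_of_isAdmissible h hZ Finset.univ
    (A := ∀ p : s, shortenedCode L (p : ℕ) ∅)
    (fun c => ∑ p : s, fun i => (((c p).1 i).val : ℝ) / (p : ℕ))
    (fun c => L.sum_mem fun p _ =>
      val_div_mem_of_mem_shortenedCode hZ (hs p p.2).ne_zero (c p).2)
    (fun _ i hi => absurd (Finset.mem_univ i) hi) ?_
  · simpa using hbound
  · intro c d hcd
    funext p
    have : Fact (p : ℕ).Prime := ⟨hs p p.2⟩
    ext i
    obtain ⟨z, hz⟩ := hcd i
    simp only [Finset.sum_apply] at hz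
    rw [← Finset.sum_sub_distrib] at hz
    have hne : ∀ r : s, ((r : ℕ) : ℝ) ≠ 0 := fun r => by exact_mod_cast (hs r r.2).ne_zero
    -- Clear denominators by the product of all primes of `s`; modulo `p` only the summand `r = p`
    -- survives, and its cofactor is a unit.
    have key : ∑ r : s, ((((c r).1 i).val : ℤ) - ((d r).1 i).val) *
        ∏ t ∈ Finset.univ.erase r, ((t : ℕ) : ℤ) = z * ∏ t : s, ((t : ℕ) : ℤ) := by
      have h1 : (∑ r : s, ((((c r).1 i).val : ℝ) / (r : ℕ) - ((d r).1 i).val / (r : ℕ))) *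
          ∏ t : s, ((t : ℕ) : ℝ) = z * ∏ t : s, ((t : ℕ) : ℝ) := by rw [hz]
      rw [Finset.sum_mul] at h1
      have h2 : ∀ r : s, ((((c r).1 i).val : ℝ) / (r : ℕ) - ((d r).1 i).val / (r : ℕ)) *
          ∏ t : s, ((t : ℕ) : ℝ) = ((((c r).1 i).val : ℝ) - ((d r).1 i).val) *
            ∏ t ∈ Finset.univ.erase r, ((t : ℕ) : ℝ) := by
        intro r
        rw [← Finset.mul_prod_erase _ _ (Finset.mem_univ r)]
        have := hne r
        field_simp
      simp only [h2] at h1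
      exact_mod_cast h1
    have hmod := congrArg (fun t : ℤ => (t : ZMod (p : ℕ))) key
    simp only [Int.cast_sum, Int.cast_mul, Int.cast_prod, Int.cast_natCast, Int.cast_sub] at hmod
    rw [Finset.sum_eq_single p, ← Finset.mul_prod_erase _ _ (Finset.mem_univ p)] at hmod
    · simp only [CharP.cast_eq_zero, zero_mul, mul_zero, mul_eq_zero] at hmod
      rcases hmod with hmod | hmod
      · simpa [sub_eq_zero] using hmod
      · obtain ⟨t, ht, h0⟩ := Finset.prod_eq_zero_iff.1 hmod
        rw [ZMod.natCast_eq_zero_iff, Nat.prime_dvd_prime_iff_eq (hs p p.2) (hs t t.2)] at h0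
        exact absurd (Subtype.ext h0.symm) (Finset.ne_of_mem_erase ht)
    · intro r _ hr
      rw [Finset.prod_eq_zero (Finset.mem_erase.2 ⟨hr.symm, Finset.mem_univ p⟩) (by simp),
        mul_zero]
    · simp

/-! ### Dimension of the codes of a centering -/

theorem intCast_mem_centering {n m : ℕ} (a : Fin m → (Fin n → ℚ)) (z : Fin n → ℤ) :
    (fun i => (z i : ℝ)) ∈ centering a :=
  Submodule.span_mono Set.subset_union_left ((mem_span_stdFrame_iff _).2 ⟨z, fun _ => rfl⟩)

/-- Multiples by the common denominator of the points of a centering are integral, and modulo a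
prime they are combinations of the numerators of the added vectors. -/
theorem exists_int_of_mem_centering {n m : ℕ} {a : Fin m → (Fin n → ℚ)} {q p : ℕ} (hpq : p ∣ q)
    {z : Fin m → Fin n → ℤ} (hz : ∀ j k, (q : ℚ) * a j k = z j k) {x : Fin n → ℝ}
    (hx : x ∈ centering a) :
    ∃ u : Fin n → ℤ, (∀ i, (q : ℝ) * x i = u i) ∧ (fun i => (u i : ZMod p)) ∈
      Submodule.span (ZMod p) (Set.range fun (j : Fin m) (k : Fin n) => (z j k : ZMod p)) := by
  induction hx using Submodule.span_induction with
  | mem x hx =>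
    rcases hx with ⟨i, rfl⟩ | ⟨j, rfl⟩
    · refine ⟨(q : ℤ) • Pi.single i 1, fun k => ?_, ?_⟩
      · rcases eq_or_ne k i with rfl | hk
        · simp [stdFrame]
        · simp [stdFrame, hk]
      · have hq : (q : ZMod p) = 0 := (ZMod.natCast_eq_zero_iff q p).2 hpq
        convert Submodule.zero_mem _ using 1
        ext k
        simp [hq]
    · refine ⟨z j, fun k => ?_, Submodule.subset_span ⟨j, rfl⟩⟩
      have := congrArg (fun t : ℚ => (t : ℝ)) (hz j k)
      simpa using this
  | zero => exact ⟨0, by simp, by convert Submodule.zero_mem _ using 1; ext k; simp⟩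
  | add x y _ _ hx hy =>
    obtain ⟨u, hu, hu'⟩ := hx
    obtain ⟨v, hv, hv'⟩ := hy
    refine ⟨u + v, fun i => by simp [mul_add, hu, hv], ?_⟩
    convert Submodule.add_mem _ hu' hv' using 1
    ext k
    simp
  | smul c x _ hx =>
    obtain ⟨u, hu, hu'⟩ := hx
    refine ⟨c • u, fun i => ?_, ?_⟩
    · simp only [Pi.smul_apply, zsmul_eq_mul, smul_eq_mul, Int.cast_mul, ← hu]
      ring
    · convert Submodule.smul_mem _ (c : ZMod p) hu' using 1
      ext k
      simp

theorem codeDim_centering_le {n m : ℕ} {a : Fin m → (Fin n → ℚ)} {q : ℕ} (hq : Squarefree q)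
    (ha : ∀ j k, ∃ z : ℤ, (q : ℚ) * a j k = (z : ℚ)) {p : ℕ} (hp : p.Prime) (hpq : p ∣ q)
    (T : Finset (Fin n)) : codeDim (centering a) p T ≤ m := by
  have : Fact p.Prime := ⟨hp⟩
  choose z hz using ha
  have hle : shortenedCode (centering a) p T ≤ Submodule.span (ZMod p)
      (Set.range fun (j : Fin m) (k : Fin n) => (z j k : ZMod p)) := by
    rintro c ⟨⟨w, hw, hwL⟩, -⟩
    obtain ⟨u, hu, hu'⟩ := exists_int_of_mem_centering hpq hz hwL
    obtain ⟨r, rfl⟩ := hpq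
    -- Square-freeness is used here: `r = q / p` is invertible modulo `p`, so a word is recovered
    -- from its `r`-fold multiple.
    have hr : (r : ZMod p) ≠ 0 := by
      rw [Ne, ZMod.natCast_eq_zero_iff]
      exact fun hdvd => hp.not_isUnit (hq p (Nat.mul_dvd_mul_left p hdvd))
    have huw : ∀ i, u i = r * w i := by
      intro i
      have hp' : (p : ℝ) ≠ 0 := by exact_mod_cast hp.ne_zero
      have := hu i
      push_cast at this
      field_simp at this
      exact_mod_cast this.symm
    have : c = (r : ZMod p)⁻¹ • fun i => (u i : ZMod p) := by
      ext i
      simp [huw, ← hw, hr]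
    rw [this]
    exact Submodule.smul_mem _ _ hu'
  refine (Submodule.finrank_mono hle).trans ?_
  simpa using! finrank_range_le_card (R := ZMod p)
    (fun (j : Fin m) (k : Fin n) => (z j k : ZMod p))

/-! ### From vanishing codes to the defect -/

/-- If all the shortened codes vanish, the lattice points that vanish on `T` are integral. -/
theorem exists_int_of_codeDim_eq_zero {n : ℕ} {L : Submodule ℤ (Fin n → ℝ)}
    (hZ : ∀ z : Fin n → ℤ, (fun i => (z i : ℝ)) ∈ L) {q : ℕ} (hq : q ≠ 0)
    (hqL : ∀ x ∈ L, ∃ z : Fin n → ℤ, ∀ i, (q : ℝ) * x i = z i) {T : Finset (Fin n)}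
    (hT : ∀ p ∈ q.primeFactors, codeDim L p T = 0) {x : Fin n → ℝ} (hx : x ∈ L)
    (hxT : ∀ i ∈ T, x i = 0) : ∃ z : Fin n → ℤ, ∀ i, x i = z i := by
  -- Denominators are removed one prime at a time, by multiplicative induction on a divisor `d` of
  -- `q` that clears them.
  have key : ∀ d : ℕ, d ∣ q → ∀ x ∈ L, (∀ i ∈ T, x i = 0) →
      (∃ z : Fin n → ℤ, ∀ i, (d : ℝ) * x i = z i) → ∃ z : Fin n → ℤ, ∀ i, x i = z i := by
    intro d
    induction d using Nat.recOnMul with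
    | zero => exact fun h => absurd (zero_dvd_iff.1 h) hq
    | one => simp
    | prime p hp =>
      rintro hpq x hx hxT ⟨z, hz⟩
      have hp' : (p : ℝ) ≠ 0 := by exact_mod_cast hp.ne_zero
      have hxz : ∀ i, x i = z i / p := fun i => by
        rw [← hz]
        field_simp
      have hmem : (fun i => (z i : ZMod p)) ∈ shortenedCode L p T := by
        rw [intCast_mem_shortenedCode hZ hp.ne_zero]
        refine ⟨by simpa only [← hxz] using hx, fun i hi => ?_⟩
        have := hz i
        rw [hxT i hi, mul_zero] at this
        have h0 : z i = 0 := by exact_mod_cast this.symm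
        simp [h0]
      rw [shortenedCode_eq_bot hp (hT p (Nat.mem_primeFactors.2 ⟨hp, hpq, hq⟩)),
        Submodule.mem_bot] at hmem
      have hdvd : ∀ i, (p : ℤ) ∣ z i := fun i =>
        (ZMod.intCast_zmod_eq_zero_iff_dvd _ _).1 (congrFun hmem i)
      choose w hw using hdvd
      refine ⟨w, fun i => ?_⟩
      rw [hxz, hw]
      push_cast
      field_simp
    | mul a b iha ihb =>
      rintro hab x hx hxT ⟨z, hz⟩
      refine ihb (dvd_of_mul_left_dvd hab) x hx hxT ?_
      refine iha (dvd_of_mul_right_dvd hab) (fun i => (b : ℝ) * x i) ?_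
        (fun i hi => by simp [hxT i hi]) ⟨z, fun i => by rw [← hz]; push_cast; ring⟩
      convert L.smul_mem (b : ℤ) hx using 1
      ext i
      simp
  obtain ⟨z, hz⟩ := hqL x hx
  exact key q dvd_rfl x hx hxT ⟨z, hz⟩

open Module in
/-- If the lattice points that vanish on `T` are integral, the defect is at most `|T|`. -/
theorem defect_le_card {n m : ℕ} {L : Submodule ℤ (Fin n → ℝ)} (hL : L ∈ squarefreeCenterings n m)
    {T : Finset (Fin n)}
    (hT : ∀ x ∈ L, (∀ i ∈ T, x i = 0) → ∃ z : Fin n → ℤ, ∀ i, x i = z i) :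
    defect (stdFrame n) L ≤ T.card := by
  classical
  obtain ⟨-, b₀, -, -⟩ := defect_spec hL
  have hstd : ∀ i, stdFrame n i ∈ L := by
    obtain ⟨a, -, rfl⟩ := hL
    exact fun i => Submodule.subset_span (Or.inl ⟨i, rfl⟩)
  have : Module.Finite ℤ L := Module.Finite.of_basis b₀
  let W : Submodule ℤ L :=
    { carrier := {x | ∀ i ∈ T, (x : Fin n → ℝ) i = 0}
      zero_mem' := by simp
      add_mem' := fun {x y} hx hy i hi => by simp [hx i hi, hy i hi]
      smul_mem' := fun c x hx i hi => by simp [hx i hi] }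
  have hmemW : ∀ x : L, x ∈ W ↔ ∀ i ∈ T, (x : Fin n → ℝ) i = 0 := fun _ => Iff.rfl
  let v : {i // i ∉ T} → W := fun i => ⟨⟨stdFrame n i, hstd i⟩, fun k hk => by
    have : k ≠ i := fun h => i.2 (h ▸ hk)
    simp [stdFrame, this]⟩
  have hv : ∀ (c : {i // i ∉ T} → ℤ) (k : Fin n),
      (((∑ i, c i • v i : W) : L) : Fin n → ℝ) k = if hk : k ∈ T then 0 else (c ⟨k, hk⟩ : ℝ) := by
    intro c k
    have h1 : (((∑ i, c i • v i : W) : L) : Fin n → ℝ) k =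
        ∑ i : {i // i ∉ T}, (c i : ℝ) * stdFrame n i k := by
      simp [v, Finset.sum_apply]
    rw [h1]
    split_ifs with hk
    · refine Finset.sum_eq_zero fun i _ => ?_
      have : k ≠ i := fun h => i.2 (h ▸ hk)
      simp [stdFrame, this]
    · rw [Finset.sum_eq_single ⟨k, hk⟩]
      · simp [stdFrame]
      · intro i _ hi
        have : k ≠ i := fun h => hi (Subtype.ext h.symm)
        simp [stdFrame, this]
      · simp
  have hli : LinearIndependent ℤ v := by
    rw [Fintype.linearIndependent_iff]
    intro c hc i
    have := hv c i
    rw [hc] at this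
    simpa [i.2] using this.symm
  have hspan : ⊤ ≤ Submodule.span ℤ (Set.range v) := by
    rintro ⟨x, hx⟩ -
    obtain ⟨z, hz⟩ := hT x x.2 hx
    rw [Submodule.mem_span_range_iff_exists_fun]
    refine ⟨fun i => z i, Subtype.ext (Subtype.ext (funext fun k => ?_))⟩
    rw [hv]
    split_ifs with hk
    · exact (hx k hk).symm
    · exact (hz k).symm
  let bW : Basis {i // i ∉ T} ℤ W := Basis.mk hli hspan
  -- `W` is cut out by the vanishing of coordinates, hence saturated. The quotient is therefore
  -- free, and lifting a basis of it completes the unit vectors of `W` to a basis of `L`.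
  have : IsAddTorsionFree (L ⧸ W) := by
    refine ⟨fun k hk x y hxy => ?_⟩
    induction x using Submodule.Quotient.induction_on with | _ x
    induction y using Submodule.Quotient.induction_on with | _ y
    simp only [← Submodule.Quotient.mk_smul] at hxy
    rw [Submodule.Quotient.eq, hmemW] at hxy ⊢
    intro i hi
    have := hxy i hi
    rw [← smul_sub] at this
    simpa [hk] using this
  have hrank : finrank ℤ (L ⧸ W) = T.card := by
    have h1 := W.finrank_quotient_add_finrank
    rw [finrank_eq_card_basis bW, finrank_eq_card_basis b₀, Fintype.card_subtype_compl,
      Fintype.card_fin, Fintype.card_coe] at h1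
    have := T.card_le_univ
    rw [Fintype.card_fin] at this
    omega
  let bQ : Basis T ℤ (L ⧸ W) := (finBasisOfFinrankEq ℤ _ hrank).reindex T.equivFin.symm
  let e : {i // i ∉ T} ⊕ T ≃ Fin n := (Equiv.sumComm _ _).trans (Equiv.sumCompl (· ∈ T))
  refine Nat.sInf_le ⟨Tᶜ, (Basis.sumQuot bW bQ).reindex e, ?_, fun i hi => ?_⟩
  · rw [Finset.card_compl, Fintype.card_fin]
    have := T.card_le_univ
    rw [Fintype.card_fin] at this
    omega
  · have hi' : i ∉ T := by simpa using hi
    have : e.symm i = Sum.inl ⟨i, hi'⟩ := by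
      rw [Equiv.symm_apply_eq]
      simp [e]
    rw [Basis.reindex_apply, this, Basis.sumQuot_inl]
    simp [bW, v]

/-! ### The quantitative estimate -/

/-- Logarithms give `b * j ≤ k * log k`. If `k ≤ X`, replace `log k` by `log X`; if `k > X`, the a
priori bound `b * j ≤ X < k` suffices. -/
theorem mul_le_mul_log_of_pow_le {p j k : ℕ} {b X : ℝ} (hp : 0 < p) (hpow : p ^ j ≤ k ^ k)
    (hb : b ≤ Real.log p) (hX : 1 ≤ Real.log X) (hj : b * j ≤ X) : b * j ≤ k * Real.log X := by
  have h1 : (j : ℝ) * Real.log p ≤ k * Real.log k := by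
    rw [← Real.log_pow, ← Real.log_pow]
    exact Real.log_le_log (by positivity) (by exact_mod_cast hpow)
  have h2 : b * j ≤ k * Real.log k := by
    nlinarith [mul_le_mul_of_nonneg_right hb (Nat.cast_nonneg (α := ℝ) j)]
  rcases Nat.eq_zero_or_pos k with rfl | hk
  · simpa using h2
  have hk' : (0 : ℝ) < k := by exact_mod_cast hk
  rcases le_or_gt (k : ℝ) X with hkX | hkX
  · exact h2.trans (mul_le_mul_of_nonneg_left (Real.log_le_log hk' hkX) hk'.le)
  · nlinarith

/-- The main estimate, in the range in which it is better than the trivial bound `n`. -/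
theorem defect_le_of_log_lt {n m : ℕ} (hm : 1 ≤ m) (hmn : m + 2 ≤ n)
    (hlog : 4 * Real.log ((m : ℝ) + 1) < Real.log ((n : ℝ) / m))
    {L : Submodule ℤ (Fin n → ℝ)} (hL : L ∈ squarefreeCenterings n m)
    (hadm : IsAdmissible (stdFrame n) L) :
    (defect (stdFrame n) L : ℝ) ≤
      9 * (n * Real.log (m * Real.log ((n : ℝ) / m)) ^ 2 / Real.log ((n : ℝ) / m)) := by
  have hL' := hL
  obtain ⟨a, ⟨q, hq, ha⟩, hLa⟩ := hL'
  have hZ : ∀ z : Fin n → ℤ, (fun i => (z i : ℝ)) ∈ L := fun z =>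
    hLa ▸ intCast_mem_centering a z
  have hqL : ∀ x ∈ L, ∃ z : Fin n → ℤ, ∀ i, (q : ℝ) * x i = z i := by
    intro x hx
    choose z hz using ha
    obtain ⟨u, hu, -⟩ := exists_int_of_mem_centering (one_dvd q) hz (hLa ▸ hx)
    exact ⟨u, hu⟩
  have hdim : ∀ p ∈ q.primeFactors, ∀ T, codeDim L p T ≤ m := fun p hp T => by
    rw [hLa]
    exact codeDim_centering_le hq ha (Nat.prime_of_mem_primeFactors hp)
      (Nat.dvd_of_mem_primeFactors hp) T
  have hm' : (1 : ℝ) ≤ m := by exact_mod_cast hm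
  have hn' : (1 : ℝ) ≤ n := by exact_mod_cast (by omega : 1 ≤ n)
  set y : ℝ := (n : ℝ) / m with hy
  set l : ℝ := Real.log y with hl
  set X : ℝ := m * l with hXdef
  have hy0 : 0 < y := by positivity
  have hmy : m * y = n := by rw [hy]; field_simp
  have hlog2 : Real.log 2 ≤ Real.log ((m : ℝ) + 1) :=
    Real.log_le_log (by norm_num) (by linarith)
  -- The factor 4 in `hlog` is large enough here because `4 * log 2 > e`; this yields `log X ≥ 1`.
  have hl1 : Real.exp 1 < l := by
    linarith [Real.log_two_gt_d9, Real.exp_one_lt_d9]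
  have hl0 : 0 < l := (Real.exp_pos 1).trans hl1
  have hlX : l ≤ X := by nlinarith
  have hX0 : 0 < X := hl0.trans_le hlX
  have hX1 : 1 ≤ Real.log X := by
    rw [Real.le_log_iff_exp_le hX0]
    linarith
  have hlogn : Real.log n ≤ 2 * l := by
    have h1 : Real.log n = Real.log m + l := by
      rw [← hmy, Real.log_mul (by positivity) hy0.ne']
    have h2 : Real.log m ≤ Real.log ((m : ℝ) + 1) := Real.log_le_log (by linarith) (by linarith)
    linarith
  have hsqrt0 : 0 < √y := Real.sqrt_pos.2 hy0
  have hlsqrt : Real.log (√y) = l / 2 := Real.log_sqrt hy0.le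
  have hl_le : l / 2 ≤ √y := hlsqrt ▸ (Real.log_le_sub_one_of_pos hsqrt0).trans (by linarith)
  set S := q.primeFactors with hS
  have hprime : ∀ p ∈ S, p.Prime := fun p hp => Nat.prime_of_mem_primeFactors hp
  -- The threshold `√y` keeps `log p ≥ l / 2` for large primes while leaving at most `√y` small
  -- ones.
  set big := S.filter (fun p : ℕ => √y < (p : ℝ)) with hbig
  have hbigS : ∀ p ∈ big, p ∈ S ∧ √y < (p : ℝ) := fun p hp => Finset.mem_filter.1 hp
  have hbiglog : ∀ p ∈ big, l / 2 ≤ Real.log p := fun p hp =>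
    hlsqrt ▸ Real.log_le_log hsqrt0 (hbigS p hp).2.le
  set κ : ℝ := (l / 2) / Real.log X with hκ
  have hκ0 : 0 < κ := by positivity
  obtain ⟨T, hTcard, hT⟩ := exists_greedy big (codeDim L) (κ := κ)
    (lt_of_lt_of_le (Nat.succ_pos _) hmn) (by
    intro p hp T
    obtain ⟨hpS, hpy⟩ := hbigS p hp
    refine le_trans ?_ (codeSupport_card_le L (hprime p hpS) T)
    rw [hκ, div_mul_eq_mul_div, div_le_iff₀ (by linarith)]
    refine mul_le_mul_log_of_pow_le (hprime p hpS).pos (pow_codeDim_le hadm hZ (hprime p hpS) T)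
      (hbiglog p hp) hX1 ?_
    have : (codeDim L p T : ℝ) ≤ m := by exact_mod_cast hdim p hpS T
    -- With this many choices the factor `exp (-κ N / n)` is at most `1 / X`.
    nlinarith) ⌈n * Real.log X / κ⌉₊
  have hinit : ∑ p ∈ big, (codeDim L p ∅ : ℝ) ≤ 4 * n := by
    have h1 := prod_pow_codeDim_le hadm hZ big fun p hp => hprime p (hbigS p hp).1
    have h2 : ∑ p ∈ big, (codeDim L p ∅ : ℝ) * Real.log p ≤ n * Real.log n := by
      have h3 : Real.log (∏ p ∈ big, (p : ℝ) ^ codeDim L p ∅) ≤ Real.log ((n : ℝ) ^ n) := by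
        refine Real.log_le_log (Finset.prod_pos fun p hp => ?_) (by exact_mod_cast h1)
        have := (hprime p (hbigS p hp).1).pos
        positivity
      rw [Real.log_prod fun p hp => by
        have := (hprime p (hbigS p hp).1).ne_zero
        positivity, Real.log_pow] at h3
      simpa only [Real.log_pow] using h3
    have h4 : (∑ p ∈ big, (codeDim L p ∅ : ℝ)) * (l / 2) ≤ n * Real.log n := by
      rw [Finset.sum_mul]
      exact (Finset.sum_le_sum fun p hp =>
        mul_le_mul_of_nonneg_left (hbiglog p hp) (Nat.cast_nonneg _)).trans h2
    have h5 : n * Real.log n ≤ n * (2 * l) := by gcongr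
    nlinarith
  have hfinal : ∑ p ∈ big, (codeDim L p T : ℝ) ≤ 4 * n / l := by
    refine hT.trans ?_
    have hexp : Real.exp (-(κ * ⌈n * Real.log X / κ⌉₊ / n)) ≤ 1 / X := by
      rw [one_div, ← Real.exp_log hX0, ← Real.exp_neg, Real.log_exp, Real.exp_le_exp,
        neg_le_neg_iff, le_div_iff₀ (by linarith)]
      have := Nat.le_ceil (n * Real.log X / κ)
      rw [div_le_iff₀ hκ0] at this
      linarith
    calc _ ≤ 4 * (n : ℝ) * (1 / X) := by gcongr
      _ ≤ 4 * n * (1 / l) := by gcongr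
      _ = 4 * n / l := by ring
  have hsmall : ∑ p ∈ S.filter (fun p : ℕ => ¬ √y < (p : ℝ)), (codeDim L p T : ℝ) ≤ 2 * n / l := by
    have hcard : ((S.filter (fun p : ℕ => ¬ √y < (p : ℝ))).card : ℝ) ≤ √y := by
      have hsub : S.filter (fun p : ℕ => ¬ √y < (p : ℝ)) ⊆ Finset.Icc 1 ⌊√y⌋₊ := by
        intro p hp
        obtain ⟨hpS, hpy⟩ := Finset.mem_filter.1 hp
        exact Finset.mem_Icc.2 ⟨(hprime p hpS).one_le, Nat.le_floor (not_lt.1 hpy)⟩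
      have := Finset.card_le_card hsub
      rw [Nat.card_Icc, Nat.add_sub_cancel] at this
      exact (Nat.cast_le.2 this).trans (Nat.floor_le hsqrt0.le)
    calc _ ≤ ∑ p ∈ S.filter (fun p : ℕ => ¬ √y < (p : ℝ)), (m : ℝ) :=
          Finset.sum_le_sum fun p hp => by exact_mod_cast hdim p (Finset.mem_filter.1 hp).1 T
      _ = (S.filter (fun p : ℕ => ¬ √y < (p : ℝ))).card * (m : ℝ) := by simp
      _ ≤ √y * m := by gcongr
      _ ≤ 2 * n / l := by
        rw [le_div_iff₀ hl0, ← hmy]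
        have := Real.mul_self_sqrt hy0.le
        have h6 : √y * l ≤ 2 * y := by nlinarith
        nlinarith
  obtain ⟨T', hT'card, hT'⟩ := exists_completion S (codeDim L)
    (fun p hp i T => codeDim_insert_le L (hprime p hp) i T)
    (fun p hp T hne => exists_codeDim_insert_lt (hprime p hp) hne) T
  have hdef : defect (stdFrame n) L ≤ T'.card := defect_le_card hL fun x hx hxT =>
    exists_int_of_codeDim_eq_zero hZ hq.ne_zero hqL hT' hx hxT
  have hsum : (defect (stdFrame n) L : ℝ) ≤
      T.card + (4 * n / l + 2 * n / l) := by
    have h1 : (defect (stdFrame n) L : ℝ) ≤ T.card + ∑ p ∈ S, (codeDim L p T : ℝ) := by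
      exact_mod_cast hdef.trans hT'card
    rw [← Finset.sum_filter_add_sum_filter_not S (fun p : ℕ => √y < (p : ℝ))] at h1
    linarith
  have hN : (T.card : ℝ) ≤ 2 * (n * Real.log X ^ 2 / l) + n / l := by
    have h1 : (T.card : ℝ) ≤ ⌈n * Real.log X / κ⌉₊ := by exact_mod_cast hTcard
    have h2 := Nat.ceil_lt_add_one (a := n * Real.log X / κ) (by positivity)
    have h3 : n * Real.log X / κ = 2 * (n * Real.log X ^ 2 / l) := by
      rw [hκ]
      field_simp
    -- Absorbs the 1 lost in rounding up.
    have h4 : 1 ≤ n / l := by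
      rw [one_le_div hl0]
      have := Real.log_le_sub_one_of_pos hy0
      nlinarith
    linarith
  have hsq : (n : ℝ) / l ≤ n * Real.log X ^ 2 / l := by
    gcongr
    exact le_mul_of_one_le_right (by linarith) (one_le_pow₀ hX1)
  have e1 : 4 * (n : ℝ) / l = 4 * (n / l) := by ring
  have e2 : 2 * (n : ℝ) / l = 2 * (n / l) := by ring
  rw [e1, e2] at hsum
  linarith

/-- Bernoulli's inequality for `(1 + 2/m) ^ m`. It keeps the iterated logarithm at least `log (log
3) > 0`. -/
theorem log_three_le_log_div_pow {n m : ℕ} (hm : 1 ≤ m) (hmn : m + 2 ≤ n) :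
    Real.log 3 ≤ Real.log (((n : ℝ) / m) ^ m) := by
  have hm' : (1 : ℝ) ≤ m := by exact_mod_cast hm
  have hmn' : (m : ℝ) + 2 ≤ n := by exact_mod_cast hmn
  refine Real.log_le_log (by norm_num) ?_
  calc (3 : ℝ) = 1 + m * (2 / m) := by field_simp; norm_num
    _ ≤ (1 + 2 / m) ^ m := one_add_mul_le_pow (by linarith [show (0 : ℝ) ≤ 2 / m by positivity]) m
    _ ≤ ((n : ℝ) / m) ^ m := by
      gcongr
      rw [le_div_iff₀ (by linarith), add_mul, div_mul_cancel₀ _ (by linarith)]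
      linarith

theorem theorem2 :
    ∃ C : ℝ, 0 < C ∧ ∀ n m : ℕ, 1 ≤ m → m + 2 ≤ n →
      (maxDefect n m : ℝ) ≤
        C * ((n : ℝ) * Real.log ((m : ℝ) + 1) / Real.log ((n : ℝ) / (m : ℝ))) *
          (Real.log (Real.log (((n : ℝ) / (m : ℝ)) ^ m))) ^ 2 := by
  have h3 : 1 < Real.log 3 := by
    rw [Real.lt_log_iff_exp_lt (by norm_num)]
    linarith [Real.exp_one_lt_d9]
  set c := Real.log (Real.log 3) with hc
  have hc0 : 0 < c := Real.log_pos h3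
  -- 18 is twice the 9 of the main estimate, as `log (m + 1) ≥ 1/2`. The term `4 / c ^ 2` covers the
  -- case `l ≤ 4 log (m + 1)`, where the trivial bound `n` is enough.
  refine ⟨18 + 4 / c ^ 2, by positivity, fun n m hm hmn => ?_⟩
  obtain ⟨L, hL, hadm, hd⟩ := (maxDefect_isGreatest n m).1
  rw [hd]
  have hX := log_three_le_log_div_pow hm hmn
  have hm' : (1 : ℝ) ≤ m := by exact_mod_cast hm
  have hmn' : (m : ℝ) + 2 ≤ n := by exact_mod_cast hmn
  have hl0 : 0 < Real.log ((n : ℝ) / m) :=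
    Real.log_pos (by rw [one_lt_div (by linarith)]; linarith)
  have hcX : c ≤ Real.log (Real.log (((n : ℝ) / m) ^ m)) := Real.log_le_log (by linarith) hX
  set l := Real.log ((n : ℝ) / m) with hl
  set w := Real.log (Real.log (((n : ℝ) / m) ^ m)) with hw
  have hlog2 : 1 / 2 ≤ Real.log ((m : ℝ) + 1) := by
    have : Real.log 2 ≤ Real.log ((m : ℝ) + 1) := Real.log_le_log (by norm_num) (by linarith)
    linarith [Real.log_two_gt_d9]
  set g := Real.log ((m : ℝ) + 1) with hg
  have hw0 : 0 < w := hc0.trans_le hcX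
  have hg0 : 0 < g := by linarith
  rcases lt_or_ge (4 * g) l with hlt | hge
  · have hmain := defect_le_of_log_lt hm hmn hlt hL hadm
    rw [← hl, ← Real.log_pow, ← hw] at hmain
    calc (defect (stdFrame n) L : ℝ) ≤ 9 * (n * w ^ 2 / l) := hmain
      _ = 18 * (n * (1 / 2) / l) * w ^ 2 := by ring
      _ ≤ (18 + 4 / c ^ 2) * (n * g / l) * w ^ 2 := by
        gcongr
        linarith [show 0 ≤ 4 / c ^ 2 by positivity]
  · obtain ⟨S, b, hSb, -⟩ := defect_spec hL
    have hle : (defect (stdFrame n) L : ℝ) ≤ n := by exact_mod_cast (by omega)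
    calc (defect (stdFrame n) L : ℝ) ≤ n := hle
      _ = 4 / c ^ 2 * (n * (l / 4) / l) * c ^ 2 := by field_simp
      _ ≤ (18 + 4 / c ^ 2) * (n * g / l) * w ^ 2 := by
        gcongr
        · linarith
        · linarith
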